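/- Let $V=\bigoplus_{n\in\mathbb Z}V_n$ be a vertex operator algebra over $\mathbb C$ of CFT type, that is, $V_n=0$ for $n<0$ and $V_0=\mathbb C\mathbf 1$. A weak $V$-module is a complex vector space $W$ with a linear map $V\to \mathrm{End}(W)[[z,z^{-1}]]$, $v\mapsto Y_W(v,z)=\sum_{n\in\mathbb Z}v_nz^{-n-1}$, such that $v_nw=0$ for $n\gg0$ (for each $v\in V$, $w\in W$), $Y_W(\mathbf 1,z)=\mathrm{id}_W$, and the Jacobi identity $$z_0^{-1}\delta\Big(\frac{z_1-z_2}{z_0}\Big)Y_W(u,z_1)Y_W(v,z_2)-z_0^{-1}\delta\Big(\frac{z_2-z_1}{-z_0}\Big)Y_W(v,z_2)Y_W(u,z_1)=z_2^{-1}\delta\Big(\frac{z_1-z_0}{z_2}\Big)Y_W(Y(u,z_0)v,z_2)$$ holds for all $u,v\in V$; no grading on $W$ is assumed. It is irreducible if $W\neq0$ and the only subspaces of $W$ stable under all operators $v_n$ ($v\in V$, $n\in\mathbb Z$) are $0$ and $W$. Let $C_2(V)$ be the linear span of $\{u_{-2}v : u,v\in V\}$ and $C_2(W)$ the linear span of $\{u_{-2}w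 : u\in V,\ w\in W\}$. Proposition. If $V$ is $C_2$-cofinite, i.e. $\dim V/C_2(V)<\infty$, and $W$ is an irreducible weak $V$-module, then $W$ is $C_2$-cofinite, i.e. $\dim W/C_2(W)<\infty$. -/

import Mathlib

/-- The Jacobi identity for `Y(v, z) = ∑ v_n z^{-n-1}` on `V` and `Y_W(v, z) = ∑ v_n z^{-n-1}` on
`W`, where the `n`-th modes are `Y v n` and `Y_W v n`:
`z₀⁻¹ δ((z₁-z₂)/z₀) Y_W(u,z₁) Y_W(v,z₂) - z₀⁻¹ δ((z₂-z₁)/(-z₀)) Y_W(v,z₂) Y_W(u,z₁)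
  = z₂⁻¹ δ((z₁-z₀)/z₂) Y_W(Y(u,z₀)v, z₂)`.
It is written as the equality, on every vector `w`, of the coefficients of
`z₀^{-l-1} z₁^{-m-1} z₂^{-n-1}` for all integers `l, m, n`; every power of a binomial is expanded in
non-negative integral powers of its second variable. The sums are finite as soon as `Y` and `Y_W`
satisfy the truncation condition. -/
def JacobiIdentity {V W : Type*} [AddCommGroup V] [Module ℂ V] [AddCommGroup W] [Module ℂ W]
    (Y : V →ₗ[ℂ] (ℤ → Module.End ℂ V)) (Y_W : V →ₗ[ℂ] (ℤ → Module.End ℂ W)) : Prop :=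
  ∀ (u v : V) (w : W) (l m n : ℤ),
    (∑ᶠ i : ℕ, ((-1 : ℂ) ^ i * ((Ring.choose l i : ℤ) : ℂ)) •
        Y_W u (m + l - i) (Y_W v (n + i) w))
      - (∑ᶠ i : ℕ, ((-1 : ℂ) ^ l * (-1 : ℂ) ^ i * ((Ring.choose l i : ℤ) : ℂ)) •
        Y_W v (n + l - i) (Y_W u (m + i) w))
    = ∑ᶠ i : ℕ, ((Ring.choose m i : ℤ) : ℂ) • Y_W (Y u (l + i) v) (m + n - i) w

/-- A vertex operator algebra structure (over `ℂ`) on the vector space `V`. -/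
structure VertexOperatorAlgebra (V : Type*) [AddCommGroup V] [Module ℂ V] where
  /-- The homogeneous subspaces `V_n`. -/
  grading : ℤ → Submodule ℂ V
  isInternal : DirectSum.IsInternal grading
  finiteDimensional : ∀ n, FiniteDimensional ℂ (grading n)
  grading_eq_bot : ∃ N : ℤ, ∀ n < N, grading n = ⊥
  /-- The state-field correspondence: `Y v n` is the mode `v_n` in `Y(v, z) = ∑ v_n z^{-n-1}`. -/
  Y : V →ₗ[ℂ] (ℤ → Module.End ℂ V)
  /-- The vacuum vector `𝟏`. -/
  vacuum : V
  /-- The conformal (Virasoro) vector `ω`. -/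
  conformal : V
  /-- The central charge `c`. -/
  centralCharge : ℂ
  vacuum_mem : vacuum ∈ grading 0
  conformal_mem : conformal ∈ grading 2
  truncation : ∀ u v : V, ∃ N : ℤ, ∀ n ≥ N, Y u n v = 0
  /-- `Y(𝟏, z) = id`. -/
  vacuum_mode : ∀ n : ℤ, Y vacuum n = if n = -1 then LinearMap.id else 0
  /-- `Y(v, z)𝟏` has no negative powers of `z`. -/
  creation : ∀ (v : V) (n : ℤ), 0 ≤ n → Y v n vacuum = 0
  /-- The constant term of `Y(v, z)𝟏` is `v`. -/
  creation_const : ∀ v : V, Y v (-1) vacuum = v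
  jacobi : JacobiIdentity Y Y
  /-- The Virasoro relations for `L(n) = ω_{n+1}`. -/
  virasoro : ∀ m n : ℤ,
    Y conformal (m + 1) * Y conformal (n + 1) - Y conformal (n + 1) * Y conformal (m + 1) =
      ((m : ℂ) - n) • Y conformal (m + n + 1) +
        if m + n = 0 then (((m : ℂ) ^ 3 - m) / 12 * centralCharge) • LinearMap.id else 0
  /-- `L(0)` acts on `V_n` as multiplication by `n`. -/
  L_zero : ∀ (n : ℤ), ∀ v ∈ grading n, Y conformal 1 v = (n : ℂ) • v
  /-- `Y(L(-1)v, z) = d/dz Y(v, z)`. -/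
  L_neg_one : ∀ (v : V) (n : ℤ), Y (Y conformal 0 v) n = (-(n : ℂ)) • Y v (n - 1)

namespace VertexOperatorAlgebra

/-- `V` is of CFT type: `V = ⨁_{n ≥ 0} V_n` and `V_0 = ℂ𝟏`. -/
def IsCFTType {V : Type*} [AddCommGroup V] [Module ℂ V] (A : VertexOperatorAlgebra V) : Prop :=
  (∀ n < 0, A.grading n = ⊥) ∧ A.grading 0 = Submodule.span ℂ {A.vacuum}

/-- `C_n(V)`: the linear span of the vectors `u_{-n} v` with `u, v ∈ V`. -/
def C {V : Type*} [AddCommGroup V] [Module ℂ V] (A : VertexOperatorAlgebra V) (n : ℕ) :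
    Submodule ℂ V :=
  Submodule.span ℂ {x | ∃ u v : V, A.Y u (-(n : ℤ)) v = x}

/-- `V` is `C_n`-cofinite: `V / C_n(V)` is finite dimensional. -/
def IsCofinite {V : Type*} [AddCommGroup V] [Module ℂ V] (A : VertexOperatorAlgebra V)
    (n : ℕ) : Prop :=
  FiniteDimensional ℂ (V ⧸ A.C n)

/-- A weak module structure on the vector space `W` over the vertex operator algebra `A`.
No grading is assumed. -/
structure WeakModule {V : Type*} [AddCommGroup V] [Module ℂ V] (A : VertexOperatorAlgebra V)
    (W : Type*) [AddCommGroup W] [Module ℂ W] where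
  /-- `Y v n` is the mode `v_n` in `Y_W(v, z) = ∑ v_n z^{-n-1}`. -/
  Y : V →ₗ[ℂ] (ℤ → Module.End ℂ W)
  truncation : ∀ (v : V) (w : W), ∃ N : ℤ, ∀ n ≥ N, Y v n w = 0
  /-- `Y_W(𝟏, z) = id`. -/
  vacuum_mode : ∀ n : ℤ, Y A.vacuum n = if n = -1 then LinearMap.id else 0
  jacobi : JacobiIdentity A.Y Y

namespace WeakModule

/-- `W` is irreducible: it is nonzero, and its only weak submodules (subspaces stable under all
modes `v_n`) are `0` and `W`. -/
def IsIrreducible {V : Type*} [AddCommGroup V] [Module ℂ V] {A : VertexOperatorAlgebra V}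
    {W : Type*} [AddCommGroup W] [Module ℂ W] (M : A.WeakModule W) : Prop :=
  Nontrivial W ∧ ∀ U : Submodule ℂ W,
    (∀ (v : V) (n : ℤ), ∀ w ∈ U, M.Y v n w ∈ U) → U = ⊥ ∨ U = ⊤

/-- `C_n(W)`: the linear span of the vectors `u_{-n} w` with `u ∈ V`, `w ∈ W`. -/
def C {V : Type*} [AddCommGroup V] [Module ℂ V] {A : VertexOperatorAlgebra V}
    {W : Type*} [AddCommGroup W] [Module ℂ W] (M : A.WeakModule W) (n : ℕ) : Submodule ℂ W :=
  Submodule.span ℂ {x | ∃ (u : V) (w : W), M.Y u (-(n : ℤ)) w = x}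

/-- `W` is `C_n`-cofinite: `W / C_n(W)` is finite dimensional. -/
def IsCofinite {V : Type*} [AddCommGroup V] [Module ℂ V] {A : VertexOperatorAlgebra V}
    {W : Type*} [AddCommGroup W] [Module ℂ W] (M : A.WeakModule W) (n : ℕ) : Prop :=
  FiniteDimensional ℂ (W ⧸ M.C n)

end WeakModule

end VertexOperatorAlgebra

/-! Fix a nonzero `w` and let `F_p` be the span of the vectors obtained from `w` by modes of
homogeneous vectors of total weight at most `p`. Irreducibility makes the `F_p` exhaust `W`. On the
associated graded space `Gr` all modes commute (`symbol_commute`), because a commutator only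
involves `u_i v` with `i ≥ 0`, of weight below `wt u + wt v`. The vector `u_{-2} v` has weight `wt u
+ wt v + 1` but acts through products of modes of `u` and `v`, hence by zero on `Gr`. So
`C_2`-cofiniteness kills every homogeneous vector of large weight
(`exists_mode_mem_filtrationPred`).

Since `u_{-1} v` acts on `Gr` by the product of the two fields (`symbol_iterate`), a high power of
the field of a `u` of positive weight vanishes, and each of its modes is nilpotent
(`isNilpotent_symbol`). The modes `u_n` with `n ≥ -1` then generate a finite dimensional commutative
algebra: only finitely many weights matter, and `u_n = 0` on `Gr` for large `n`. Applied to the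
class of `w`, this algebra gives a finite dimensional space which, with the images of the modes `n ≤
-2`, fills `Gr` (`exists_fg_sup_span_symbol_eq_top`). Those images come from `C_2(W)`
(`mode_mem_C_two`); lifting to `W` and inducting on `p` concludes. -/

section ModeFormulas

/-! ### Special cases of the Jacobi identity. -/

variable {V W : Type*} [AddCommGroup V] [Module ℂ V] [AddCommGroup W] [Module ℂ W]
  {Y : V →ₗ[ℂ] (ℤ → Module.End ℂ V)} {Y_W : V →ₗ[ℂ] (ℤ → Module.End ℂ W)}

theorem JacobiIdentity.commutator (h : JacobiIdentity Y Y_W) (u v : V) (w : W) (m n : ℤ) :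
    Y_W u m (Y_W v n w) - Y_W v n (Y_W u m w) =
      ∑ᶠ i : ℕ, ((Ring.choose m i : ℤ) : ℂ) • Y_W (Y u i v) (m + n - i) w := by
  have := h u v w 0 m n
  rw [finsum_eq_single _ 0, finsum_eq_single _ 0] at this
  · simpa using this
  · intro i hi
    simp [Ring.choose_zero_ite, hi]
  · intro i hi
    simp [Ring.choose_zero_ite, hi]

theorem JacobiIdentity.iterate (h : JacobiIdentity Y Y_W) (u v : V) (w : W) (l n : ℤ) :
    Y_W (Y u l v) n w =
      (∑ᶠ i : ℕ, ((-1 : ℂ) ^ i * ((Ring.choose l i : ℤ) : ℂ)) •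
        Y_W u (l - i) (Y_W v (n + i) w))
      - (∑ᶠ i : ℕ, ((-1 : ℂ) ^ l * (-1 : ℂ) ^ i * ((Ring.choose l i : ℤ) : ℂ)) •
        Y_W v (n + l - i) (Y_W u i w)) := by
  have := h u v w l 0 n
  rw [finsum_eq_single (fun i : ℕ => ((Ring.choose (0 : ℤ) i : ℤ) : ℂ) •
    Y_W (Y u (l + i) v) (0 + n - i) w) 0] at this
  · simpa using this.symm
  · intro i hi
    simp [Ring.choose_zero_ite, hi]

theorem neg_one_pow_mul_choose_neg (r : ℤ) (i : ℕ) :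
    (-1 : ℂ) ^ i * ((Ring.choose (-r) i : ℤ) : ℂ) = ((Ring.choose (r + i - 1) i : ℤ) : ℂ) := by
  rw [Ring.choose_neg, Units.smul_def, smul_eq_mul, Int.cast_mul, ← mul_assoc,
    Int.coe_negOnePow_natCast]
  push_cast
  rw [← mul_pow]
  simp

/-- For `l = -1` every coefficient is `1`: this is the normally ordered product. -/
theorem JacobiIdentity.iterate_neg_one (h : JacobiIdentity Y Y_W) (u v : V) (w : W) (n : ℤ) :
    Y_W (Y u (-1) v) n w =
      (∑ᶠ i : ℕ, Y_W u (-1 - i) (Y_W v (n + i) w)) +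
        ∑ᶠ i : ℕ, Y_W v (n - 1 - i) (Y_W u i w) := by
  have hc (i : ℕ) : (-1 : ℂ) ^ i * ((Ring.choose (-1 : ℤ) i : ℤ) : ℂ) = 1 := by
    have := Ring.choose_natCast (R := ℤ) i i
    rw [neg_one_pow_mul_choose_neg]
    simp_all
  rw [h.iterate, sub_eq_add_neg, ← finsum_neg_distrib]
  simp [hc, sub_eq_add_neg]

end ModeFormulas

/-! ### Homogeneous components and weights of modes. -/

namespace VertexOperatorAlgebra

variable {V : Type*} [AddCommGroup V] [Module ℂ V] (A : VertexOperatorAlgebra V)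

/-- The projection of `V` to the homogeneous subspace `V_k`. -/
noncomputable def proj (k : ℤ) : V →ₗ[ℂ] V :=
  letI := A.isInternal.chooseDecomposition
  (A.grading k).subtype ∘ₗ DirectSum.component ℂ ℤ (fun i => A.grading i) k ∘ₗ
    (DirectSum.decomposeLinearEquiv A.grading).toLinearMap

theorem proj_mem (k : ℤ) (v : V) : A.proj k v ∈ A.grading k := by
  simp [proj]

theorem proj_of_mem {k : ℤ} {v : V} (hv : v ∈ A.grading k) : A.proj k v = v := by
  let := A.isInternal.chooseDecomposition
  exact DirectSum.decompose_of_mem_same A.grading hv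

theorem proj_of_mem_ne {j k : ℤ} {v : V} (hv : v ∈ A.grading j) (hjk : j ≠ k) :
    A.proj k v = 0 := by
  let := A.isInternal.chooseDecomposition
  exact DirectSum.decompose_of_mem_ne A.grading hv hjk

theorem grading_induction {p : V → Prop} (zero : p 0)
    (mem : ∀ k : ℤ, ∀ v ∈ A.grading k, p v) (add : ∀ u v, p u → p v → p (u + v)) (v : V) :
    p v := by
  let := A.isInternal.chooseDecomposition
  exact DirectSum.Decomposition.inductionOn A.grading zero (fun {i} m => mem i m m.2) add v

theorem eq_zero_of_proj_eq_zero {v : V} (hv : ∀ k, A.proj k v = 0) : v = 0 := by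
  let := A.isInternal.chooseDecomposition
  apply (DirectSum.decomposeLinearEquiv A.grading).injective
  rw [map_zero]
  ext k
  exact hv k

theorem exists_forall_proj_eq_zero (v : V) : ∃ N : ℕ, ∀ d : ℕ, N ≤ d → A.proj d v = 0 := by
  refine A.grading_induction (p := fun v => ∃ N : ℕ, ∀ d : ℕ, N ≤ d → A.proj d v = 0)
    ⟨0, by simp⟩ (fun k v hv => ⟨k.toNat + 1, fun d hd => A.proj_of_mem_ne hv (by omega)⟩) ?_ v
  rintro u v ⟨M, hM⟩ ⟨N, hN⟩
  exact ⟨max M N, fun d hd => by simp [hM d (by omega), hN d (by omega)]⟩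

theorem proj_L_zero (k : ℤ) (v : V) :
    A.proj k (A.Y A.conformal 1 v) = (k : ℂ) • A.proj k v := by
  refine A.grading_induction
    (p := fun v => A.proj k (A.Y A.conformal 1 v) = (k : ℂ) • A.proj k v) (by simp) ?_ ?_ v
  · intro j v hv
    rw [A.L_zero j v hv, map_smul]
    by_cases hjk : j = k
    · rw [hjk]
    · simp [A.proj_of_mem_ne hv hjk]
  · intro u v hu hv
    simp [hu, hv]

theorem mem_grading_of_L_zero {k : ℤ} {v : V} (hv : A.Y A.conformal 1 v = (k : ℂ) • v) :
    v ∈ A.grading k := by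
  have : v - A.proj k v = 0 := by
    apply A.eq_zero_of_proj_eq_zero
    intro j
    rw [map_sub]
    by_cases hjk : k = j
    · rw [← hjk, A.proj_of_mem (A.proj_mem k v), sub_self]
    · rw [A.proj_of_mem_ne (A.proj_mem k v) hjk, sub_zero]
      have h := A.proj_L_zero j v
      rw [hv, map_smul, ← sub_eq_zero, ← sub_smul, smul_eq_zero, sub_eq_zero, Int.cast_inj] at h
      exact h.resolve_left hjk
  rw [sub_eq_zero.mp this]
  exact A.proj_mem k v

/-- The commutator of `L(0) = ω_1` with `u_n` has only the terms `i = 0, 1`, given by `L(-1)u` and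
`L(0)u`; so `u_n v` is an `L(0)`-eigenvector, and `L(0)`-eigenvectors with integral eigenvalue are
homogeneous. -/
theorem mode_mem_grading {d e : ℤ} {u v : V} (hu : u ∈ A.grading d) (hv : v ∈ A.grading e)
    (n : ℤ) : A.Y u n v ∈ A.grading (d + e - n - 1) := by
  apply A.mem_grading_of_L_zero
  have h := A.jacobi.commutator A.conformal u v 1 n
  rw [A.L_zero e v hv, finsum_eq_sum_of_support_subset (s := {0, 1})] at h
  · rw [Finset.sum_pair (by simp)] at h
    simp only [Ring.choose_zero_right, Ring.choose_one_right, Nat.cast_zero, Nat.cast_one,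
      Int.cast_one, one_smul, A.L_neg_one, A.L_zero d u hu, map_smul, Pi.smul_apply,
      LinearMap.smul_apply] at h
    rw [sub_eq_iff_eq_add] at h
    rw [h]
    simp only [add_sub_cancel_left, sub_zero]
    push_cast
    module
  · intro i hi
    have : i < 2 := by
      by_contra! h2
      apply hi
      have : Ring.choose (1 : ℤ) i = 0 := by
        have := Ring.choose_natCast (R := ℤ) 1 i
        rw [Nat.choose_eq_zero_of_lt (by omega)] at this
        simpa using this
      simp [this]
    have : i = 0 ∨ i = 1 := by omega
    simpa using this

/-! ### Modes of index at most `-2` and `C_2(W)`. -/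

namespace WeakModule

variable {A} {W : Type*} [AddCommGroup W] [Module ℂ W] (M : A.WeakModule W)

/-- This is the derivative property of `u_{-2}𝟏`. Only the vacuum mode of index `-1` is nonzero; for
`n ≤ -1` it occurs exactly once, in the first sum, with coefficient `k + 1 = -n`. -/
theorem mode_translate (u : V) (w : W) {n : ℤ} (hn : n ≤ -1) :
    M.Y (A.Y u (-2) A.vacuum) n w = (-(n : ℂ)) • M.Y u (n - 1) w := by
  obtain ⟨k, rfl⟩ : ∃ k : ℕ, n = -1 - k := ⟨(-1 - n).toNat, by omega⟩
  rw [M.jacobi.iterate, finsum_eq_single _ k, finsum_eq_zero_of_forall_eq_zero]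
  · rw [neg_one_pow_mul_choose_neg, M.vacuum_mode, if_pos (by ring)]
    have := Ring.choose_natCast (R := ℤ) (k + 1) k
    rw [Nat.choose_succ_self_right] at this
    rw [show (2 : ℤ) + k - 1 = ((k + 1 : ℕ) : ℤ) by push_cast; ring, this, sub_zero,
      show (-2 : ℤ) - k = -1 - k - 1 by ring]
    push_cast
    rw [id_eq]
    congr 1
    ring
  · intro i
    rw [M.vacuum_mode, if_neg (by omega)]
    simp
  · intro i hi
    rw [M.vacuum_mode, if_neg (by omega)]
    simp

/-- All modes `u_n` with `n ≤ -2` map into `C_2(W)`. -/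
theorem mode_mem_C_two (u : V) (w : W) {n : ℤ} (hn : n ≤ -2) : M.Y u n w ∈ M.C 2 := by
  obtain ⟨k, rfl⟩ : ∃ k : ℕ, n = -2 - k := ⟨(-2 - n).toNat, by omega⟩
  clear hn
  induction k generalizing u with
  | zero => exact Submodule.subset_span ⟨u, w, by simp⟩
  | succ k ih =>
    have h := M.mode_translate u w (n := -2 - k) (by omega)
    have h0 : (-((-2 - k : ℤ) : ℂ)) ≠ 0 := by
      rw [neg_ne_zero, Int.cast_ne_zero]
      omega
    rw [show (-2 : ℤ) - ((k + 1 : ℕ) : ℤ) = -2 - k - 1 by push_cast; ring,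
      ← (M.C 2).smul_mem_iff h0, ← h]
    exact ih _

end WeakModule

end VertexOperatorAlgebra

/-! ### The filtration by total conformal weight. -/

namespace VertexOperatorAlgebra

namespace WeakModule

variable {V : Type*} [AddCommGroup V] [Module ℂ V] {A : VertexOperatorAlgebra V}
  {W : Type*} [AddCommGroup W] [Module ℂ W] (M : A.WeakModule W) (w : W)

/-- `M.IsMonomial w p x` says that `x` is obtained from `w` by applying modes of homogeneous
vectors of total weight at most `p`. -/
inductive IsMonomial : ℕ → W → Prop
  | base (p : ℕ) : IsMonomial p w
  | mode {p : ℕ} {x : W} (d : ℕ) (u : V) (hu : u ∈ A.grading d) (n : ℤ) (hx : IsMonomial p x) :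
      IsMonomial (p + d) (M.Y u n x)

/-- The filtration of the submodule generated by `w` by total conformal weight. -/
def filtration (p : ℕ) : Submodule ℂ W :=
  Submodule.span ℂ {x | M.IsMonomial w p x}

/-- The previous step of `filtration`, which is `0` for `p = 0`. -/
def filtrationPred : ℕ → Submodule ℂ W
  | 0 => ⊥
  | p + 1 => M.filtration w p

variable {M w}

theorem IsMonomial.succ {p : ℕ} {x : W} (hx : M.IsMonomial w p x) : M.IsMonomial w (p + 1) x := by
  induction hx with
  | base p => exact .base _
  | mode d u hu n hx ih =>
    rw [add_right_comm]
    exact ih.mode d u hu n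

theorem mem_filtration_base (p : ℕ) : w ∈ M.filtration w p :=
  Submodule.subset_span (.base p)

theorem filtration_mono : Monotone (M.filtration w) :=
  monotone_nat_of_le_succ fun _ => Submodule.span_mono fun _ hx => IsMonomial.succ hx

theorem filtration_le_filtrationPred {p q : ℕ} (h : p < q) :
    M.filtration w p ≤ M.filtrationPred w q := by
  cases q with
  | zero => omega
  | succ q => exact filtration_mono (by omega)

theorem mode_mem_filtration_add {p d : ℕ} {u : V} {x : W} (hu : u ∈ A.grading d)
    (hx : x ∈ M.filtration w p) (n : ℤ) : M.Y u n x ∈ M.filtration w (p + d) := by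
  induction hx using Submodule.span_induction with
  | mem x hx => exact Submodule.subset_span (hx.mode d u hu n)
  | zero => simp
  | add x y _ _ hx hy => rw [map_add]; exact add_mem hx hy
  | smul c x _ hx => rw [map_smul]; exact Submodule.smul_mem _ c hx

theorem mode_mem_filtrationPred_add {p d : ℕ} {u : V} {x : W} (hu : u ∈ A.grading d)
    (hx : x ∈ M.filtrationPred w p) (n : ℤ) : M.Y u n x ∈ M.filtrationPred w (p + d) := by
  cases p with
  | zero =>
    rw [(Submodule.mem_bot ℂ).mp hx, map_zero]
    exact zero_mem _
  | succ p =>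
    exact filtration_le_filtrationPred (by omega) (mode_mem_filtration_add hu hx n)

theorem eq_zero_of_neg (hCFT : A.IsCFTType) {k : ℤ} (hk : k < 0) {u : V}
    (hu : u ∈ A.grading k) : u = 0 := by
  rw [hCFT.1 k hk] at hu
  exact (Submodule.mem_bot ℂ).mp hu

theorem mode_mem_filtration (hCFT : A.IsCFTType) {p q : ℕ} {k : ℤ} (hk : p + k ≤ q) {u : V}
    {x : W} (hu : u ∈ A.grading k) (hx : x ∈ M.filtration w p) (n : ℤ) :
    M.Y u n x ∈ M.filtration w q := by
  rcases lt_or_ge k 0 with h | h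
  · simp [eq_zero_of_neg hCFT h hu]
  · lift k to ℕ using h
    exact filtration_mono (by omega) (mode_mem_filtration_add hu hx n)

theorem mode_mem_filtrationPred (hCFT : A.IsCFTType) {p q : ℕ} {k : ℤ} (hk : p + k < q) {u : V}
    {x : W} (hu : u ∈ A.grading k) (hx : x ∈ M.filtration w p) (n : ℤ) :
    M.Y u n x ∈ M.filtrationPred w q := by
  rcases lt_or_ge k 0 with h | h
  · simp [eq_zero_of_neg hCFT h hu]
  · lift k to ℕ using h
    exact filtration_le_filtrationPred (by omega) (mode_mem_filtration_add hu hx n)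

theorem finsum_mem_submodule (N : Submodule ℂ W) {f : ℕ → W} (hf : ∀ i, f i ∈ N) :
    ∑ᶠ i, f i ∈ N :=
  finsum_induction (· ∈ N) N.zero_mem (fun _ _ => N.add_mem) hf

/-- Each `u_i v` with `i ≥ 0` has weight `d + e - i - 1 < d + e`. -/
theorem commutator_mem_filtrationPred (hCFT : A.IsCFTType) {p d e : ℕ} {u v : V} {x : W}
    (hu : u ∈ A.grading d) (hv : v ∈ A.grading e) (hx : x ∈ M.filtration w p) (m n : ℤ) :
    M.Y u m (M.Y v n x) - M.Y v n (M.Y u m x) ∈ M.filtrationPred w (p + d + e) := by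
  rw [M.jacobi.commutator]
  refine finsum_mem_submodule _ fun i => Submodule.smul_mem _ _ ?_
  exact mode_mem_filtrationPred hCFT (by omega) (A.mode_mem_grading hu hv i) hx _

/-- The bound `d + e` holds for every `l`, even when `u_l v` has larger weight: the iterate formula
uses one mode of `u` and one of `v` in each term. -/
theorem mode_iterate_mem_filtration {p d e : ℕ} {u v : V} {x : W}
    (hu : u ∈ A.grading d) (hv : v ∈ A.grading e) (hx : x ∈ M.filtration w p) (l n : ℤ) :
    M.Y (A.Y u l v) n x ∈ M.filtration w (p + d + e) := by
  rw [M.jacobi.iterate]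
  refine sub_mem (finsum_mem_submodule _ fun i => Submodule.smul_mem _ _ ?_)
    (finsum_mem_submodule _ fun i => Submodule.smul_mem _ _ ?_)
  · rw [add_right_comm]
    exact mode_mem_filtration_add hu (mode_mem_filtration_add hv hx _) _
  · exact mode_mem_filtration_add hv (mode_mem_filtration_add hu hx _) _

variable (M w) in
/-- The vectors whose homogeneous components act on the filtration with degree lower than their
weight. -/
def lowering : Submodule ℂ V where
  carrier := {v | ∀ (d p : ℕ) (n : ℤ), ∀ x ∈ M.filtration w p,
    M.Y (A.proj d v) n x ∈ M.filtrationPred w (p + d)}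
  zero_mem' d p n x hx := by simp
  add_mem' {u v} hu hv d p n x hx := by
    simpa using add_mem (hu d p n x hx) (hv d p n x hx)
  smul_mem' c v hv d p n x hx := by
    simpa using Submodule.smul_mem _ c (hv d p n x hx)

theorem mode_neg_two_mem_lowering (hCFT : A.IsCFTType) (u v : V) :
    A.Y u (-2) v ∈ M.lowering w := by
  refine A.grading_induction (p := fun u => A.Y u (-2) v ∈ M.lowering w) (by simp) ?_
    (fun a b ha hb => by simpa using add_mem ha hb) u
  intro j u hu
  refine A.grading_induction (p := fun v => A.Y u (-2) v ∈ M.lowering w) (by simp) ?_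
    (fun a b ha hb => by simpa using add_mem ha hb) v
  intro k v hv
  rcases lt_or_ge j 0 with h | hj
  · simp [eq_zero_of_neg hCFT h hu]
  rcases lt_or_ge k 0 with h | hk
  · simp [eq_zero_of_neg hCFT h hv]
  lift j to ℕ using hj
  lift k to ℕ using hk
  intro d p n x hx
  have h := A.mode_mem_grading hu hv (-2)
  rcases eq_or_ne ((j : ℤ) + k - -2 - 1) d with hd | hd
  · rw [A.proj_of_mem (hd ▸ h)]
    exact filtration_le_filtrationPred (by omega) (mode_iterate_mem_filtration hu hv hx _ _)
  · simp [A.proj_of_mem_ne h hd]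

theorem C_two_le_lowering (hCFT : A.IsCFTType) : A.C 2 ≤ M.lowering w := by
  refine Submodule.span_le.mpr ?_
  rintro _ ⟨u, v, rfl⟩
  exact mode_neg_two_mem_lowering hCFT u v

/-- If `V` is `C_2`-cofinite, then homogeneous vectors of large weight act on the filtration with
degree lower than their weight. -/
theorem exists_mode_mem_filtrationPred (hCFT : A.IsCFTType) (hV : A.IsCofinite 2) :
    ∃ p₀ : ℕ, ∀ d : ℕ, p₀ ≤ d → ∀ u ∈ A.grading d, ∀ (p : ℕ) (n : ℤ), ∀ x ∈ M.filtration w p,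
      M.Y u n x ∈ M.filtrationPred w (p + d) := by
  obtain ⟨s, hs⟩ := (Module.finite_def.mp hV : (⊤ : Submodule ℂ (V ⧸ A.C 2)).FG)
  choose lift hlift using Submodule.mkQ_surjective (A.C 2)
  choose N hN using A.exists_forall_proj_eq_zero
  have htop : A.C 2 ⊔ Submodule.span ℂ (lift '' s) = ⊤ := by
    rw [← Submodule.map_mkQ_eq_top, Submodule.map_span, ← Set.image_comp]
    simpa [Function.comp_def, hlift] using hs
  -- Beyond this bound the finitely many lifts spanning `V` modulo `C_2(V)` have no component, so
  -- `V_d` consists of components of elements of `C_2(V)`.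
  refine ⟨s.sup (N ∘ lift), fun d hd u hu p n x hx => ?_⟩
  have key : A.C 2 ⊔ Submodule.span ℂ (lift '' s) ≤
      ((M.filtrationPred w (p + d)).comap
        ((LinearMap.applyₗ x ∘ₗ LinearMap.proj n ∘ₗ M.Y) ∘ₗ A.proj d)) := by
    refine sup_le (fun v hv => C_two_le_lowering hCFT hv d p n x hx) (Submodule.span_le.mpr ?_)
    rintro _ ⟨y, hy, rfl⟩
    have : A.proj d (lift y) = 0 := hN _ d ((Finset.le_sup (f := N ∘ lift) hy).trans hd)
    simp [this]
  have := key (htop ▸ Submodule.mem_top (x := u))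
  simpa [A.proj_of_mem hu] using this

theorem exists_mem_filtration (hCFT : A.IsCFTType) (hM : M.IsIrreducible) (hw : w ≠ 0) (x : W) :
    ∃ p, x ∈ M.filtration w p := by
  have hdir : Directed (· ≤ ·) (M.filtration w) := filtration_mono.directed_le
  have htop : ⨆ p, M.filtration w p = ⊤ := by
    refine (hM.2 _ fun v n x hx => ?_).resolve_left fun h => hw ?_
    · obtain ⟨p, hp⟩ := (Submodule.mem_iSup_of_directed _ hdir).mp hx
      refine A.grading_induction (p := fun v => M.Y v n x ∈ ⨆ p, M.filtration w p) (by simp) ?_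
        (fun a b ha hb => by simpa using add_mem ha hb) v
      intro k u hu
      exact Submodule.mem_iSup_of_mem (p + k.toNat)
        (mode_mem_filtration hCFT (by omega) hu hp n)
    · exact (Submodule.mem_bot ℂ).mp (h ▸ Submodule.mem_iSup_of_mem 0 (mem_filtration_base 0))
  exact (Submodule.mem_iSup_of_directed _ hdir).mp (htop ▸ Submodule.mem_top)

end WeakModule

end VertexOperatorAlgebra

/-! ### The associated graded space and the operators induced by modes. -/

namespace VertexOperatorAlgebra

namespace WeakModule

variable {V : Type*} [AddCommGroup V] [Module ℂ V] {A : VertexOperatorAlgebra V}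
  {W : Type*} [AddCommGroup W] [Module ℂ W] (M : A.WeakModule W) (w : W)

/-- The Rees module of the filtration. -/
def rees : Submodule ℂ (ℕ →₀ W) where
  carrier := {f | ∀ p, f p ∈ M.filtration w p}
  zero_mem' _ := zero_mem _
  add_mem' hf hg p := add_mem (hf p) (hg p)
  smul_mem' c _ hf p := Submodule.smul_mem _ c (hf p)

/-- The elements of the Rees module whose components lie in the previous step. -/
def reesPred : Submodule ℂ (M.rees w) where
  carrier := {f | ∀ p, f.1 p ∈ M.filtrationPred w p}
  zero_mem' _ := zero_mem _
  add_mem' hf hg p := add_mem (hf p) (hg p)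
  smul_mem' c _ hf p := Submodule.smul_mem _ c (hf p)

/-- The associated graded space of the filtration. -/
abbrev Gr : Type _ := M.rees w ⧸ M.reesPred w

/-- An element of the `p`-th step as an element of degree `p` of the Rees module. -/
noncomputable def reesSingle (p : ℕ) : M.filtration w p →ₗ[ℂ] M.rees w :=
  (Finsupp.lsingle p ∘ₗ (M.filtration w p).subtype).codRestrict (M.rees w) fun x q => by
    rcases eq_or_ne p q with rfl | h
    · simp
    · simp [Finsupp.single_eq_of_ne' h]

/-- The class in the associated graded space of an element of the `p`-th step. -/
noncomputable def cls (p : ℕ) : M.filtration w p →ₗ[ℂ] M.Gr w :=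
  (M.reesPred w).mkQ ∘ₗ M.reesSingle w p

/-- A mode of a vector of weight `d`, shifting the degree by `d`. -/
noncomputable def shiftMode (d : ℕ) (n : ℤ) : V →ₗ[ℂ] Module.End ℂ (ℕ →₀ W) where
  toFun u := Finsupp.lmapDomain W ℂ (· + d) ∘ₗ Finsupp.mapRange.linearMap (M.Y u n)
  map_add' u v := by
    ext
    simp [← Finsupp.single_add, Finsupp.mapDomain_single]
  map_smul' c u := by
    ext
    simp

variable {M w}

theorem coe_reesSingle {p : ℕ} (x : M.filtration w p) :
    (M.reesSingle w p x : ℕ →₀ W) = Finsupp.single p (x : W) :=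
  rfl

theorem shiftMode_single (d : ℕ) (n : ℤ) (u : V) (p : ℕ) (x : W) :
    M.shiftMode d n u (Finsupp.single p x) = Finsupp.single (p + d) (M.Y u n x) := by
  simp [shiftMode]

theorem shiftMode_apply_add (d : ℕ) (n : ℤ) (u : V) (f : ℕ →₀ W) (p : ℕ) :
    M.shiftMode d n u f (p + d) = M.Y u n (f p) := by
  simp [shiftMode, Finsupp.mapDomain_apply (add_left_injective d)]

theorem shiftMode_apply_of_lt {d : ℕ} (n : ℤ) (u : V) (f : ℕ →₀ W) {q : ℕ} (hq : q < d) :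
    M.shiftMode d n u f q = 0 := by
  refine Finsupp.mapDomain_of_notMem_range _ _ ?_
  rintro ⟨p, hp⟩
  simp only at hp
  omega

theorem shiftMode_mem_rees {d : ℕ} {u : V} (hu : u ∈ A.grading d) (n : ℤ) {f : ℕ →₀ W}
    (hf : f ∈ M.rees w) : M.shiftMode d n u f ∈ M.rees w := by
  intro q
  rcases lt_or_ge q d with h | h
  · rw [shiftMode_apply_of_lt n u f h]
    exact zero_mem _
  · obtain ⟨p, rfl⟩ := Nat.exists_eq_add_of_le' h
    rw [shiftMode_apply_add]
    exact mode_mem_filtration_add hu (hf p) n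

theorem shiftMode_mem_reesPred {d : ℕ} {u : V} (hu : u ∈ A.grading d) (n : ℤ) {f : M.rees w}
    (hf : f ∈ M.reesPred w) :
    (⟨M.shiftMode d n u f, shiftMode_mem_rees hu n f.2⟩ : M.rees w) ∈ M.reesPred w := by
  intro q
  rcases lt_or_ge q d with h | h
  · simp only
    rw [shiftMode_apply_of_lt n u f.1 h]
    exact zero_mem _
  · obtain ⟨p, rfl⟩ := Nat.exists_eq_add_of_le' h
    simp only
    rw [shiftMode_apply_add]
    exact mode_mem_filtrationPred_add hu (hf p) n

variable (M w) in
/-- The operator induced by the mode `u_n` of a vector `u` of weight `d` on the associated graded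
space. -/
noncomputable def symbol (d : ℕ) (n : ℤ) : A.grading d →ₗ[ℂ] Module.End ℂ (M.Gr w) where
  toFun u := Submodule.mapQ _ _
    ((M.shiftMode d n u.1).restrict fun _ hf => shiftMode_mem_rees u.2 n hf)
    fun _ hf => shiftMode_mem_reesPred u.2 n hf
  map_add' u v := by
    refine Submodule.linearMap_qext _ (LinearMap.ext fun f => ?_)
    exact congrArg (Submodule.Quotient.mk (p := M.reesPred w))
      (a₂ := (M.shiftMode d n u.1).restrict (fun _ hf => shiftMode_mem_rees u.2 n hf) f +
        (M.shiftMode d n v.1).restrict (fun _ hf => shiftMode_mem_rees v.2 n hf) f) (Subtype.ext (by simp))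
  map_smul' c u := by
    refine Submodule.linearMap_qext _ (LinearMap.ext fun f => ?_)
    exact congrArg (Submodule.Quotient.mk (p := M.reesPred w))
      (a₂ := c • (M.shiftMode d n u.1).restrict (fun _ hf => shiftMode_mem_rees u.2 n hf) f) (Subtype.ext (by simp))

theorem symbol_mk {d : ℕ} (n : ℤ) (u : A.grading d) (f : M.rees w) :
    M.symbol w d n u (Submodule.Quotient.mk f) =
      Submodule.Quotient.mk ⟨M.shiftMode d n u.1 f, shiftMode_mem_rees u.2 n f.2⟩ :=
  rfl

theorem symbol_cls {d : ℕ} (n : ℤ) (u : A.grading d) {p : ℕ} (x : M.filtration w p) :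
    M.symbol w d n u (M.cls w p x) =
      M.cls w (p + d) ⟨M.Y u n x, mode_mem_filtration_add u.2 x.2 n⟩ := by
  simp only [cls, LinearMap.comp_apply, Submodule.mkQ_apply, symbol_mk]
  congr 1
  ext1
  simp [coe_reesSingle, shiftMode_single]

theorem cls_eq_cls {p q : ℕ} (h : p = q) {x : M.filtration w p} {y : M.filtration w q}
    (hxy : (x - y : W) ∈ M.filtrationPred w p) : M.cls w p x = M.cls w q y := by
  subst h
  refine (Submodule.Quotient.eq _).mpr fun q => ?_
  rcases eq_or_ne p q with rfl | h
  · simpa [coe_reesSingle] using hxy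
  · simp [coe_reesSingle, Finsupp.single_eq_of_ne' h]

theorem cls_eq_zero {p : ℕ} {x : M.filtration w p} (hx : (x : W) ∈ M.filtrationPred w p) :
    M.cls w p x = 0 := by
  rw [← map_zero (M.cls w p)]
  exact cls_eq_cls rfl (by simpa using hx)

theorem mem_of_cls_mem {N : Submodule ℂ (M.Gr w)} (h : ∀ p x, M.cls w p x ∈ N) (g : M.Gr w) :
    g ∈ N := by
  induction g using Submodule.Quotient.induction_on with
  | H f =>
    have hf : f = ∑ p ∈ f.1.support, M.reesSingle w p ⟨f.1 p, f.2 p⟩ := by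
      ext1
      simp only [AddSubmonoidClass.coe_finsetSum, coe_reesSingle]
      exact f.1.sum_single.symm
    rw [hf, ← Submodule.mkQ_apply, map_sum]
    exact sum_mem fun p _ => h p _

theorem gr_hom_ext {S T : Module.End ℂ (M.Gr w)}
    (h : ∀ p x, S (M.cls w p x) = T (M.cls w p x)) : S = T := by
  refine LinearMap.ext fun g => ?_
  exact mem_of_cls_mem (N := LinearMap.eqLocus S T) h g

theorem symbol_commute (hCFT : A.IsCFTType) {d e : ℕ} (m n : ℤ) (u : A.grading d)
    (v : A.grading e) :
    M.symbol w d m u * M.symbol w e n v = M.symbol w e n v * M.symbol w d m u := by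
  refine gr_hom_ext fun p x => ?_
  simp only [Module.End.mul_apply, symbol_cls]
  refine cls_eq_cls (add_right_comm _ _ _) ?_
  have := commutator_mem_filtrationPred hCFT u.2 v.2 x.2 m n
  rwa [add_right_comm] at this

/-- The class of the generator. -/
noncomputable def generator : M.Gr w := M.cls w 0 ⟨w, mem_filtration_base 0⟩

/-- The class of `w` generates `Gr` under the induced modes. In positive degree `w` itself has class
zero, as it lies in the previous step. -/
theorem eq_top_of_symbol_mem {N : Submodule ℂ (M.Gr w)} (h0 : generator ∈ N)
    (h : ∀ (d : ℕ) (n : ℤ) (u : A.grading d), ∀ g ∈ N, M.symbol w d n u g ∈ N) : N = ⊤ := by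
  rw [eq_top_iff]
  rintro g -
  have key : ∀ p y, M.IsMonomial w p y → ∃ hy : y ∈ M.filtration w p, M.cls w p ⟨y, hy⟩ ∈ N := by
    intro p y hy
    induction hy with
    | base p =>
      refine ⟨mem_filtration_base p, ?_⟩
      cases p with
      | zero => exact h0
      | succ p =>
        rw [cls_eq_zero (mem_filtration_base p)]
        exact N.zero_mem
    | mode d u hu n hx ih =>
      obtain ⟨hy, ih⟩ := ih
      exact ⟨mode_mem_filtration_add hu hy n, symbol_cls n ⟨u, hu⟩ ⟨_, hy⟩ ▸ h d n ⟨u, hu⟩ _ ih⟩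
  refine mem_of_cls_mem (fun p x => ?_) g
  obtain ⟨x, hx⟩ := x
  have hx' := hx
  rw [filtration] at hx'
  induction hx' using Submodule.span_induction with
  | mem y hy => exact (key p y hy).2
  | zero =>
    have : (⟨0, hx⟩ : M.filtration w p) = 0 := rfl
    rw [this, map_zero]
    exact N.zero_mem
  | add a b ha hb iha ihb =>
    have : (⟨a + b, hx⟩ : M.filtration w p) = ⟨a, ha⟩ + ⟨b, hb⟩ := rfl
    rw [this, map_add]
    exact N.add_mem (iha ha) (ihb hb)
  | smul c a ha iha =>
    have : (⟨c • a, hx⟩ : M.filtration w p) = c • ⟨a, ha⟩ := rfl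
    rw [this, map_smul]
    exact N.smul_mem c (iha ha)

/-- The kernel of an induced mode is stable under all the others, by commutativity. -/
theorem symbol_eq_zero_of_generator (hCFT : A.IsCFTType) {d : ℕ} {n : ℤ} {u : A.grading d}
    (h : M.symbol w d n u generator = 0) : M.symbol w d n u = 0 := by
  rw [← LinearMap.ker_eq_top]
  refine eq_top_of_symbol_mem h fun e m v g hg => ?_
  rw [LinearMap.mem_ker] at hg ⊢
  rw [← Module.End.mul_apply, symbol_commute hCFT, Module.End.mul_apply, hg, map_zero]

/-- Truncation on `w` alone becomes truncation uniform on `Gr`, which makes the fields power series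
up to a shift. -/
theorem exists_symbol_eq_zero (hCFT : A.IsCFTType) {d : ℕ} (u : A.grading d) :
    ∃ N : ℕ, ∀ n : ℤ, N ≤ n → M.symbol w d n u = 0 := by
  obtain ⟨N, hN⟩ := M.truncation u w
  refine ⟨N.toNat, fun n hn => symbol_eq_zero_of_generator hCFT ?_⟩
  rw [generator, symbol_cls]
  refine cls_eq_zero ?_
  simp only [hN n (by omega)]
  exact zero_mem _

theorem symbol_vacuum (n : ℤ) :
    M.symbol w 0 n ⟨A.vacuum, A.vacuum_mem⟩ = if n = -1 then 1 else 0 := by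
  refine gr_hom_ext fun p x => ?_
  rw [symbol_cls]
  split_ifs with h
  · exact cls_eq_cls rfl (by simp [M.vacuum_mode, h])
  · exact cls_eq_zero (by simp [M.vacuum_mode, h])

/-- On `Gr` the factors of `v_{n-1-i} u_i` may be swapped and the terms `i ≥ N` vanish, so both
halves of the normally ordered product merge into one sum, with `u` of index `N - 1 - s`. The bound
on `K` depends on `x` through truncation. -/
theorem symbol_iterate_cls (hCFT : A.IsCFTType) {d e f : ℕ} (u : A.grading d) (v : A.grading e)
    (huv : A.Y u (-1) v ∈ A.grading f) (hf : f = d + e) {N : ℕ}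
    (hN : ∀ n : ℤ, N ≤ n → M.symbol w d n u = 0) (n : ℤ) (p : ℕ) (x : M.filtration w p) :
    ∃ K₀ : ℕ, ∀ K ≥ K₀, M.symbol w f n ⟨A.Y u (-1) v, huv⟩ (M.cls w p x) =
      (∑ s ∈ Finset.range (N + K), M.symbol w d (N - 1 - s) u * M.symbol w e (n - N + s) v)
        (M.cls w p x) := by
  subst hf
  obtain ⟨K₁, hK₁⟩ := M.truncation u x
  obtain ⟨K₂, hK₂⟩ := M.truncation v x
  refine ⟨N + K₁.toNat + (K₂ - n).toNat, fun K hK => ?_⟩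
  have h1 (i : ℕ) : M.Y u (-1 - i) (M.Y v (n + i) x) ∈ M.filtration w (p + (d + e)) := by
    rw [add_comm d e, ← add_assoc]
    exact mode_mem_filtration_add u.2 (mode_mem_filtration_add v.2 x.2 _) _
  have h2 (i : ℕ) : M.Y v (n - 1 - i) (M.Y u i x) ∈ M.filtration w (p + (d + e)) := by
    rw [← add_assoc]
    exact mode_mem_filtration_add v.2 (mode_mem_filtration_add u.2 x.2 _) _
  have hsum : M.symbol w (d + e) n ⟨A.Y u (-1) v, huv⟩ (M.cls w p x) =
      M.cls w (p + (d + e)) (∑ i ∈ Finset.range K, ⟨_, h1 i⟩ +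
        ∑ i ∈ Finset.range K, ⟨_, h2 i⟩) := by
    rw [symbol_cls]
    congr 1
    ext1
    simp only [Submodule.coe_add, AddSubmonoidClass.coe_finsetSum]
    rw [M.jacobi.iterate_neg_one, finsum_eq_sum_of_support_subset (s := Finset.range K),
      finsum_eq_sum_of_support_subset (s := Finset.range K)]
    · intro i hi
      simp only [Finset.coe_range, Set.mem_Iio]
      by_contra! h
      exact hi (by simp [hK₁ i (by omega)])
    · intro i hi
      simp only [Finset.coe_range, Set.mem_Iio]
      by_contra! h
      exact hi (by simp [hK₂ (n + i) (by omega)])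
  rw [hsum, map_add, map_sum, map_sum, Finset.sum_range_add, add_comm, LinearMap.add_apply,
    LinearMap.sum_apply, LinearMap.sum_apply]
  congr 1
  · have hzero : ∀ i ∈ Finset.range K, i ∉ Finset.range N →
        M.cls w (p + (d + e)) ⟨_, h2 i⟩ = 0 := by
      intro i _ hi
      have := symbol_cls (n - 1 - i) v (⟨_, mode_mem_filtration_add u.2 x.2 i⟩ :
        M.filtration w (p + d))
      rw [← symbol_cls, hN i (by simpa using hi), LinearMap.zero_apply, map_zero] at this
      rw [this]
      exact cls_eq_cls (add_assoc _ _ _).symm (by simp)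
    rw [← Finset.sum_subset (Finset.range_subset_range.mpr (by omega)) hzero,
      ← Finset.sum_range_reflect]
    refine Finset.sum_congr rfl fun s hs => ?_
    have hs' := Finset.mem_range.mp hs
    rw [symbol_commute hCFT, Module.End.mul_apply, symbol_cls, symbol_cls]
    refine cls_eq_cls (add_assoc _ _ _).symm ?_
    have h3 : ((N - 1 - s : ℕ) : ℤ) = N - 1 - s := by omega
    have h4 : n - 1 - ((N : ℤ) - 1 - s) = n - N + s := by ring
    simp [h3, h4]
  · refine Finset.sum_congr rfl fun s _ => ?_
    rw [Module.End.mul_apply, symbol_cls, symbol_cls]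
    refine cls_eq_cls (by ring) ?_
    have h3 : ((N : ℤ) - 1 - ((N + s : ℕ) : ℤ)) = -1 - s := by push_cast; ring
    have h4 : n - N + ((N + s : ℕ) : ℤ) = n + s := by push_cast; ring
    simp only [h3, h4, sub_self]
    exact zero_mem _

/-- On the associated graded space, `u_{-1} v` acts by the product of the fields of `u` and
`v`. -/
theorem symbol_iterate (hCFT : A.IsCFTType) {d e f : ℕ} (u : A.grading d) (v : A.grading e)
    (huv : A.Y u (-1) v ∈ A.grading f) (hf : f = d + e) {N : ℕ} {K : ℤ}
    (hN : ∀ n : ℤ, N ≤ n → M.symbol w d n u = 0) (hK : ∀ n, K ≤ n → M.symbol w e n v = 0)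
    (j : ℕ) : M.symbol w f (N + K - 1 - j) ⟨A.Y u (-1) v, huv⟩ =
      ∑ st ∈ Finset.HasAntidiagonal.antidiagonal j,
        M.symbol w d (N - 1 - st.1) u * M.symbol w e (K - 1 - st.2) v := by
  refine gr_hom_ext fun p x => ?_
  obtain ⟨K₀, h⟩ := symbol_iterate_cls hCFT u v huv hf hN (N + K - 1 - j) p x
  -- The range is enlarged to contain all `s ≤ j`; for `s > j` the mode of `v` has index at least
  -- `K`, hence is zero.
  rw [h (K₀ + (j + 1)) (by omega), Finset.Nat.sum_antidiagonal_eq_sum_range_succ_mk,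
    ← Finset.sum_subset (Finset.range_subset_range.mpr (show j + 1 ≤ N + (K₀ + (j + 1)) by omega))]
  · congr 1
    refine Finset.sum_congr rfl fun s hs => ?_
    have := Finset.mem_range.mp hs
    simp only
    congr 3
    omega
  · intro s _ hs
    have := Finset.mem_range.not.mp hs
    rw [hK _ (by omega), mul_zero]

theorem symbol_iterate_eq_zero (hCFT : A.IsCFTType) {d e f : ℕ} (u : A.grading d)
    (v : A.grading e) (huv : A.Y u (-1) v ∈ A.grading f) (hf : f = d + e) {N : ℕ} {K : ℤ}
    (hN : ∀ n : ℤ, N ≤ n → M.symbol w d n u = 0) (hK : ∀ n, K ≤ n → M.symbol w e n v = 0)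
    {n : ℤ} (hn : N + K ≤ n) : M.symbol w f n ⟨A.Y u (-1) v, huv⟩ = 0 := by
  refine gr_hom_ext fun p x => ?_
  obtain ⟨K₀, h⟩ := symbol_iterate_cls hCFT u v huv hf hN n p x
  rw [h K₀ le_rfl, Finset.sum_eq_zero]
  intro s _
  rw [hK _ (by omega), mul_zero]

end WeakModule

end VertexOperatorAlgebra

/-! ### Nilpotency and finiteness for commuting elements. -/

section CommutingSets

/-- The coefficients of a nilpotent power series over a commutative ring are nilpotent. -/
theorem PowerSeries.isNilpotent_coeff_of_isNilpotent {R : Type*} [CommRing R] {f : PowerSeries R}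
    (hf : IsNilpotent f) (n : ℕ) : IsNilpotent (PowerSeries.coeff n f) := by
  rw [nilpotent_iff_mem_prime]
  -- Modulo a prime, power series have coefficients in a domain and so form a reduced ring.
  intro J hJ
  have h := (hf.map (PowerSeries.map (Ideal.Quotient.mk J))).eq_zero
  rw [← Ideal.Quotient.eq_zero_iff_mem, ← PowerSeries.coeff_map, h, map_zero]

/-- If the coefficients of a power series commute, then they are nilpotent as soon as the power
series is. -/
theorem PowerSeries.isNilpotent_coeff_of_commute {E : Type*} [Ring E] {f : PowerSeries E}
    (hc : ∀ m n, PowerSeries.coeff m f * PowerSeries.coeff n f =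
      PowerSeries.coeff n f * PowerSeries.coeff m f)
    (hf : IsNilpotent f) (n : ℕ) : IsNilpotent (PowerSeries.coeff n f) := by
  let S := Subring.closure (Set.range fun n => PowerSeries.coeff n f)
  have : IsMulCommutative S := Subring.isMulCommutative_closure <| by
    rintro _ ⟨m, rfl⟩ _ ⟨n, rfl⟩
    exact hc m n
  let : CommRing S := { (inferInstance : Ring S) with mul_comm := this.is_comm.comm }
  let g : PowerSeries S :=
    PowerSeries.mk fun n => ⟨PowerSeries.coeff n f, Subring.subset_closure ⟨n, rfl⟩⟩
  have hg : PowerSeries.map S.subtype g = f := by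
    ext n
    simp [g]
  have hinj : Function.Injective (PowerSeries.map S.subtype) :=
    PowerSeries.map_injective _ Subtype.val_injective
  have hnil : IsNilpotent g := (IsNilpotent.map_iff hinj).mp (hg ▸ hf)
  have := (PowerSeries.isNilpotent_coeff_of_isNilpotent hnil n).map S.subtype
  simpa [g] using this

/-- Finitely many commuting integral elements generate a finite algebra. -/
theorem fg_adjoin_of_finite_of_commute {K E : Type*} [CommRing K] [Ring E] [Algebra K E]
    {s : Set E} (hs : s.Finite) (hc : ∀ x ∈ s, ∀ y ∈ s, x * y = y * x)
    (hi : ∀ x ∈ s, IsIntegral K x) : (Subalgebra.toSubmodule (Algebra.adjoin K s)).FG := by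
  have := Algebra.isMulCommutative_adjoin K hc
  let S := Algebra.adjoin K s
  let : CommRing S := { (inferInstance : Ring S) with mul_comm := this.is_comm.comm }
  have h := fg_adjoin_of_finite (R := K) (A := S) (s := Subtype.val ⁻¹' s)
    (hs.preimage Subtype.val_injective.injOn)
    (fun x hx => (isIntegral_algHom_iff S.val Subtype.val_injective).mp (hi _ hx))
  rw [Algebra.adjoin_adjoin_coe_preimage] at h
  have := h.map S.val.toLinearMap
  rw [Algebra.top_toSubmodule, Submodule.map_top] at this
  exact (Submodule.range_subtype (Subalgebra.toSubmodule S)) ▸ this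

end CommutingSets

/-! ### Nilpotent modes and finiteness modulo `C_2(W)`. -/

namespace VertexOperatorAlgebra

namespace WeakModule

variable {V : Type*} [AddCommGroup V] [Module ℂ V] {A : VertexOperatorAlgebra V}
  {W : Type*} [AddCommGroup W] [Module ℂ W] {M : A.WeakModule W} {w : W}

/-- The powers of the generating series of the modes of `u` on the associated graded space are the
generating series of `u_{-1} ⋯ u_{-1} 𝟏`. -/
theorem exists_symbol_eq_coeff_pow (hCFT : A.IsCFTType) {d : ℕ} (u : A.grading d) {N : ℕ}
    (hN : ∀ n : ℤ, N ≤ n → M.symbol w d n u = 0) (k f : ℕ) (hf : f = k * d) :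
    ∃ b : A.grading f,
      (∀ j : ℕ, M.symbol w f (k * N - 1 - j) b =
        PowerSeries.coeff j ((PowerSeries.mk fun i : ℕ => M.symbol w d (N - 1 - i) u) ^ k)) ∧
      ∀ n : ℤ, k * N ≤ n → M.symbol w f n b = 0 := by
  induction k generalizing f with
  | zero =>
    obtain rfl : f = 0 := by simpa using hf
    refine ⟨⟨A.vacuum, A.vacuum_mem⟩, fun j => ?_, fun n hn => ?_⟩
    · rw [symbol_vacuum, pow_zero, PowerSeries.coeff_one]
      exact if_congr (by simp) rfl rfl
    · rw [symbol_vacuum, if_neg (by simp at hn; omega)]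
  | succ k ih =>
    obtain ⟨b, hb, hb0⟩ := ih (k * d) rfl
    have hmem : A.Y u (-1) b ∈ A.grading f := by
      have := A.mode_mem_grading u.2 b.2 (-1)
      convert this using 2
      rw [hf]
      push_cast
      ring
    have hf' : f = d + k * d := by rw [hf]; ring
    refine ⟨⟨_, hmem⟩, fun j => ?_, fun n hn => ?_⟩
    · have := symbol_iterate hCFT u b hmem hf' hN hb0 j
      rw [show (((k + 1 : ℕ) : ℤ) * N - 1 - j) = N + k * N - 1 - j by push_cast; ring, this,
        pow_succ', PowerSeries.coeff_mul]
      refine Finset.sum_congr rfl fun st _ => ?_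
      rw [hb, PowerSeries.coeff_mk]
    · refine symbol_iterate_eq_zero hCFT u b hmem hf' hN hb0 ?_
      push_cast at hn
      linarith

theorem exists_symbol_eq_zero_of_le (hCFT : A.IsCFTType) (hV : A.IsCofinite 2) :
    ∃ p₀ : ℕ, ∀ d : ℕ, p₀ ≤ d → ∀ (n : ℤ) (u : A.grading d), M.symbol w d n u = 0 := by
  obtain ⟨p₀, hp₀⟩ := exists_mode_mem_filtrationPred (M := M) (w := w) hCFT hV
  refine ⟨p₀, fun d hd n u => gr_hom_ext fun p x => ?_⟩
  rw [symbol_cls]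
  exact cls_eq_zero (hp₀ d hd u u.2 p n x x.2)

/-- The `p₀`-th power of the field of `u` is the field of a vector of weight `p₀ * d ≥ p₀`, hence
zero; this needs `d > 0`. -/
theorem isNilpotent_symbol (hCFT : A.IsCFTType) (hV : A.IsCofinite 2) {d : ℕ} (hd : 0 < d)
    (n : ℤ) (u : A.grading d) : IsNilpotent (M.symbol w d n u) := by
  obtain ⟨p₀, hp₀⟩ := exists_symbol_eq_zero_of_le (M := M) (w := w) hCFT hV
  obtain ⟨N, hN⟩ := exists_symbol_eq_zero (M := M) (w := w) hCFT u
  rcases le_or_gt (N : ℤ) n with h | h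
  · rw [hN n h]
    exact IsNilpotent.zero
  obtain ⟨b, hb, -⟩ := exists_symbol_eq_coeff_pow hCFT u hN p₀ _ rfl
  have hnil : IsNilpotent (PowerSeries.mk fun i : ℕ => M.symbol w d (N - 1 - i) u) := by
    refine ⟨p₀, ?_⟩
    ext1 j
    rw [← hb, hp₀ _ (Nat.le_mul_of_pos_right _ hd), map_zero]
  have := PowerSeries.isNilpotent_coeff_of_commute (fun i j => by
    simp only [PowerSeries.coeff_mk]
    exact symbol_commute hCFT _ _ u u) hnil (N - 1 - n).toNat
  rw [PowerSeries.coeff_mk] at this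
  rwa [show (N : ℤ) - 1 - ((N - 1 - n).toNat : ℕ) = n by omega] at this

/-- In weight zero CFT type leaves only multiples of the vacuum, whose mode `-1` is a scalar and
need not be nilpotent; integrality covers both cases. -/
theorem isIntegral_symbol (hCFT : A.IsCFTType) (hV : A.IsCofinite 2) (d : ℕ) (n : ℤ)
    (u : A.grading d) : IsIntegral ℂ (M.symbol w d n u) := by
  rcases Nat.eq_zero_or_pos d with rfl | hd
  · have hu : (u : V) ∈ Submodule.span ℂ {A.vacuum} := hCFT.2 ▸ u.2
    obtain ⟨c, hc⟩ := Submodule.mem_span_singleton.mp hu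
    obtain rfl : c • (⟨A.vacuum, A.vacuum_mem⟩ : A.grading (0 : ℕ)) = u := Subtype.ext hc
    rw [map_smul, symbol_vacuum]
    refine IsIntegral.smul c ?_
    split_ifs
    · exact isIntegral_one
    · exact isIntegral_zero
  · obtain ⟨k, hk⟩ := isNilpotent_symbol (M := M) (w := w) hCFT hV hd n u
    exact ⟨Polynomial.X ^ k, Polynomial.monic_X_pow k, by simp [hk]⟩

/-- The associated graded space is the sum of a finite dimensional subspace and of the images of
the modes `u_n` with `n ≤ -2`. -/
theorem exists_fg_sup_span_symbol_eq_top (hCFT : A.IsCFTType) (hV : A.IsCofinite 2) :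
    ∃ D : Submodule ℂ (M.Gr w), D.FG ∧
      D ⊔ Submodule.span ℂ {g | ∃ (d : ℕ) (n : ℤ) (u : A.grading d) (h : M.Gr w),
        n ≤ -2 ∧ M.symbol w d n u h = g} = ⊤ := by
  obtain ⟨p₀, hp₀⟩ := exists_symbol_eq_zero_of_le (M := M) (w := w) hCFT hV
  have hfin (d : ℕ) : ∃ s : Finset (A.grading d), Submodule.span ℂ (s : Set (A.grading d)) = ⊤ :=
    (A.finiteDimensional d).fg_top
  choose s hs using hfin
  let T : Set (Module.End ℂ (M.Gr w)) :=
    ⋃ d ∈ Finset.range p₀, ⋃ b ∈ s d, (fun n => M.symbol w d n b) '' Set.Ici (-1)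
  have hT : T.Finite := by
    refine Set.Finite.biUnion (Finset.finite_toSet _) fun d _ =>
      Set.Finite.biUnion (Finset.finite_toSet _) fun b _ => ?_
    obtain ⟨N, hN⟩ := exists_symbol_eq_zero (M := M) (w := w) hCFT b
    refine (((Set.finite_Icc (-1 : ℤ) N).image fun n => M.symbol w d n b).union
      (Set.finite_singleton 0)).subset ?_
    rintro _ ⟨n, hn, rfl⟩
    rcases le_or_gt n N with h | h
    · exact Or.inl ⟨n, ⟨hn, h⟩, rfl⟩
    · exact Or.inr (hN n h.le)
  have hTmem : ∀ x ∈ T, ∃ (d : ℕ) (n : ℤ) (u : A.grading d), M.symbol w d n u = x := by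
    intro x hx
    simp only [T, Set.mem_iUnion] at hx
    obtain ⟨d, _, b, _, n, _, rfl⟩ := hx
    exact ⟨d, n, b, rfl⟩
  have hB := fg_adjoin_of_finite_of_commute (K := ℂ) hT
    (fun x hx y hy => by
      obtain ⟨d, m, u, rfl⟩ := hTmem x hx
      obtain ⟨e, n, v, rfl⟩ := hTmem y hy
      exact symbol_commute hCFT m n u v)
    (fun x hx => by
      obtain ⟨d, m, u, rfl⟩ := hTmem x hx
      exact isIntegral_symbol hCFT hV d m u)
  have hmem (d : ℕ) (n : ℤ) (hn : -1 ≤ n) (u : A.grading d) :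
      M.symbol w d n u ∈ Algebra.adjoin ℂ T := by
    rcases le_or_gt p₀ d with hd | hd
    · rw [hp₀ d hd]
      exact zero_mem _
    · have : (⊤ : Submodule ℂ (A.grading d)) ≤
          (Subalgebra.toSubmodule (Algebra.adjoin ℂ T)).comap (M.symbol w d n) := by
        rw [← hs d]
        refine Submodule.span_le.mpr fun b hb => Algebra.subset_adjoin ?_
        simp only [T, Set.mem_iUnion]
        exact ⟨d, Finset.mem_range.mpr hd, b, hb, n, hn, rfl⟩
      exact this trivial
  -- `D` is the algebra applied to the class of `w`. Modes with `n ≥ -1` preserve both summands, and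
  -- those with `n ≤ -2` map everything into the second.
  refine ⟨_, hB.map (LinearMap.applyₗ generator), eq_top_of_symbol_mem ?_ ?_⟩
  · exact Submodule.mem_sup_left ⟨1, one_mem (Algebra.adjoin ℂ T), rfl⟩
  · intro d n u g hg
    rcases le_or_gt n (-2) with hn | hn
    · exact Submodule.mem_sup_right (Submodule.subset_span ⟨d, n, u, g, hn, rfl⟩)
    · rw [← Submodule.mem_comap]
      refine (sup_le ?_ ?_ : _ ⊔ _ ≤ Submodule.comap (M.symbol w d n u) _) hg
      · rintro _ ⟨a, ha, rfl⟩
        exact Submodule.mem_sup_left 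
          ⟨M.symbol w d n u * a, (Algebra.adjoin ℂ T).mul_mem (hmem d n (by omega) u) ha, rfl⟩
      · refine Submodule.span_le.mpr ?_
        rintro _ ⟨e, m, v, h, hm, rfl⟩
        refine Submodule.mem_sup_right (Submodule.subset_span ⟨e, m, v, M.symbol w d n u h, hm, ?_⟩)
        rw [← Module.End.mul_apply, symbol_commute hCFT, Module.End.mul_apply]

/-- Up to `C_2(W)` and a fixed finite dimensional subspace, every step of the filtration is
contained in the previous one. -/
theorem exists_fg_filtration_le (hCFT : A.IsCFTType) (hV : A.IsCofinite 2) :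
    ∃ E : Submodule ℂ W, E.FG ∧
      ∀ p, M.filtration w p ≤ M.filtrationPred w p ⊔ (E ⊔ M.C 2) := by
  obtain ⟨D, ⟨t, rfl⟩, htop⟩ := exists_fg_sup_span_symbol_eq_top (M := M) (w := w) hCFT hV
  choose lift hlift using Submodule.mkQ_surjective (M.reesPred w)
  -- All components of chosen lifts of the generators of `D`.
  let s : Set W := ⋃ g ∈ t, Set.range (lift g).1
  have hs : s.Finite :=
    Set.Finite.biUnion (Finset.finite_toSet _) fun g _ => Finsupp.finite_range _
  refine ⟨Submodule.span ℂ s, Submodule.fg_span hs, ?_⟩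
  let E := Submodule.span ℂ s
  let K : Submodule ℂ (M.rees w) :=
    { carrier := {f | ∀ p, f.1 p ∈ M.filtrationPred w p ⊔ (E ⊔ M.C 2)}
      zero_mem' := fun p => zero_mem _
      add_mem' := fun hf hg p => add_mem (hf p) (hg p)
      smul_mem' := fun c _ hf p => Submodule.smul_mem _ c (hf p) }
  have hK : M.reesPred w ≤ K := fun f hf p => Submodule.mem_sup_left (hf p)
  -- `K` contains the kernel of the projection to `Gr`, so surjecting onto `Gr` forces it to be the
  -- whole Rees module.
  have hKtop : K.map (M.reesPred w).mkQ = ⊤ := by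
    rw [eq_top_iff, ← htop]
    refine sup_le (Submodule.span_le.mpr fun g hg => ⟨lift g, fun p => ?_, hlift g⟩)
      (Submodule.span_le.mpr ?_)
    · refine Submodule.mem_sup_right (Submodule.mem_sup_left (Submodule.subset_span ?_))
      simp only [s, Set.mem_iUnion]
      exact ⟨g, hg, p, rfl⟩
    · rintro _ ⟨d, n, u, h, hn, rfl⟩
      obtain ⟨f, rfl⟩ := Submodule.mkQ_surjective _ h
      refine ⟨⟨_, shiftMode_mem_rees u.2 n f.2⟩, fun q => ?_, (symbol_mk n u f).symm⟩
      simp only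
      rcases lt_or_ge q d with h | h
      · rw [shiftMode_apply_of_lt n u.1 f.1 h]
        exact zero_mem _
      · obtain ⟨p, rfl⟩ := Nat.exists_eq_add_of_le' h
        rw [shiftMode_apply_add]
        exact Submodule.mem_sup_right (Submodule.mem_sup_right (M.mode_mem_C_two _ _ hn))
  rw [Submodule.map_mkQ_eq_top, sup_eq_right.mpr hK] at hKtop
  intro p x hx
  have : M.reesSingle w p ⟨x, hx⟩ ∈ K := hKtop ▸ Submodule.mem_top
  simpa [coe_reesSingle] using this p

end WeakModule

end VertexOperatorAlgebra

theorem proposition5p2 {V : Type*} [AddCommGroup V] [Module ℂ V] (A : VertexOperatorAlgebra V)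
    (hCFT : A.IsCFTType) (hV : A.IsCofinite 2)
    {W : Type*} [AddCommGroup W] [Module ℂ W] (M : A.WeakModule W) (hM : M.IsIrreducible) :
    M.IsCofinite 2 := by
  have := hM.1
  obtain ⟨w, hw⟩ := exists_ne (0 : W)
  obtain ⟨E, hE, hstep⟩ :=
    VertexOperatorAlgebra.WeakModule.exists_fg_filtration_le (M := M) (w := w) hCFT hV
  have hle (p : ℕ) : M.filtration w p ≤ E ⊔ M.C 2 := by
    induction p with
    | zero => exact (hstep 0).trans (sup_le bot_le le_rfl)
    | succ p ih => exact (hstep (p + 1)).trans (sup_le ih le_rfl)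
  have htop : M.C 2 ⊔ E = ⊤ := by
    rw [sup_comm, eq_top_iff]
    rintro x -
    obtain ⟨p, hp⟩ := VertexOperatorAlgebra.WeakModule.exists_mem_filtration hCFT hM hw x
    exact hle p hp
  have hfg := hE.map (M.C 2).mkQ
  rw [(Submodule.map_mkQ_eq_top _ _).mpr htop] at hfg
  exact Module.finite_def.mpr hfg
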